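/- Let $\Theta\subseteq\mathbb R$ be the set of admissible parameter values, $\delta\ge 0$ a tolerance, $t\mapsto\rho(t)$ ($t\in\Theta$) a family of density matrices on a fixed finite-dimensional Hilbert space, and $\mu$ a Borel probability measure (prior) on $\mathbb R$ that is concentrated on $\Theta$; $\rho$ is assumed $\mu$-measurable. For a POVM $Q$ on $\mathbb R$ acting on $n$ copies put $$p_n(t,Q)=\operatorname{Tr}\big[\rho(t)^{\otimes n}\,Q(\{\tau:|t-\tau|\le\delta\})\big],\qquad \eta^*_n=\sup_Q\int p_n(t,Q)\,\mathrm d\mu(t),\qquad \overline\eta^*_n=\sup_Q\inf_{t\in\Theta}p_n(t,Q),$$ where the suprema run over all such POVMs, and define the asymptotic rates $$R^*=\limsup_{n\to\infty}-\tfrac1n\log(1-\eta^*_n),\qquad \overline R^*=\limsup_{n\to\infty}-\tfrac1n\log(1-\overline\eta^*_n)$$ in $[-\infty,\infty]$ (these are the limits whenever the limits exist). Let $C(\rho,\sigma)=-\inf_{0\le s\le1}\log\operatorname{Tr}[\rho^s\sigma^{1-s}]$ be the quantum Chernoff divergence. Then $\overline R^*\le R^*$, and the rates obey the following upper bounds,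 in which an infimum over the empty set is $\infty$. 1. There is a set $S\subseteq\Theta\cap\operatorname{supp}\mu$ whose complement is $\mu$-null such that $$\overline R^*\le R^*\le\inf_{t,t'\in S,\ |t-t'|>2\delta}C(\rho(t),\rho(t')).$$ 2. If $\rho$ is continuous on $\Theta$, then no exceptional values are needed: $$\overline R^*\le R^*\le\inf_{t,t'\in\Theta\cap\operatorname{supp}\mu,\ |t-t'|>2\delta}C(\rho(t),\rho(t')).$$ 3. For the minimax rate, without any continuity assumption, $$\overline R^*\le\inf_{t,t'\in\Theta,\ |t-t'|>2\delta}C(\rho(t),\rho(t')).$$ -/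

import Mathlib

open MeasureTheory Filter Topology
open scoped ENNReal

noncomputable section

namespace PACMetrology

open scoped ComplexOrder

/-- A quantum state (density matrix) of a finite-dimensional system whose Hilbert space has
an orthonormal basis indexed by `ι`: a positive semidefinite matrix of trace one. -/
def IsState {ι : Type*} [Fintype ι] (ρ : Matrix ι ι ℂ) : Prop :=
  ρ.PosSemidef ∧ ρ.trace = 1

/-- The `n`-fold tensor power `ρ^{⊗ n}`, with the product basis indexed by `Fin n → ι`. -/
def tensorPower {ι : Type*} (n : ℕ) (ρ : Matrix ι ι ℂ) :
    Matrix (Fin n → ι) (Fin n → ι) ℂ :=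
  Matrix.of fun i j => ∏ k, ρ (i k) (j k)

/-- A POVM with outcomes in `ℝ` (the estimate `τ`): a countably additive function on the Borel
sets of `ℝ` with positive semidefinite values and total value the identity. -/
structure POVM (κ : Type*) [Fintype κ] [DecidableEq κ] where
  /-- the effect assigned to each Borel set of estimates -/
  effect : VectorMeasure ℝ (Matrix κ κ ℂ)
  /-- all effects are positive semidefinite -/
  posSemidef : ∀ s : Set ℝ, MeasurableSet s → (effect s).PosSemidef
  /-- normalization -/
  effect_univ : effect Set.univ = 1

section SuccessProbability

variable {κ : Type*} [Fintype κ] [DecidableEq κ]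

/-- The probability `∫ w_δ(t - τ) Tr[ρ(t) Q(dτ)]`, where `w_δ(x) = 1` if `|x| ≤ δ` and `0`
otherwise, that the estimate `τ` is within the tolerance `δ` of `t`. -/
def hitProb (δ : ℝ) (ρ : ℝ → Matrix κ κ ℂ) (Q : POVM κ) (t : ℝ) : ℝ≥0∞ :=
  ENNReal.ofReal (ρ t * Q.effect {τ : ℝ | |t - τ| ≤ δ}).trace.re

/-- Bayesian success probability `η(δ, μ, ρ, Q)`. -/
def bayesSuccess (δ : ℝ) (μ : Measure ℝ) (ρ : ℝ → Matrix κ κ ℂ) (Q : POVM κ) : ℝ≥0∞ :=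
  ∫⁻ t, hitProb δ ρ Q t ∂μ

/-- Minimax success probability for the parameter domain `Θ`. -/
def minimaxSuccess (δ : ℝ) (Θ : Set ℝ) (ρ : ℝ → Matrix κ κ ℂ) (Q : POVM κ) : ℝ≥0∞ :=
  ⨅ t ∈ Θ, hitProb δ ρ Q t

/-- Optimal Bayesian success probability `η*(δ, μ, ρ)`. -/
def optBayesSuccess (δ : ℝ) (μ : Measure ℝ) (ρ : ℝ → Matrix κ κ ℂ) : ℝ≥0∞ :=
  ⨆ Q : POVM κ, bayesSuccess δ μ ρ Q

/-- Optimal minimax success probability for the parameter domain `Θ`. -/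
def optMinimaxSuccess (δ : ℝ) (Θ : Set ℝ) (ρ : ℝ → Matrix κ κ ℂ) : ℝ≥0∞ :=
  ⨆ Q : POVM κ, minimaxSuccess δ Θ ρ Q

end SuccessProbability

/-- The asymptotic error rate of a sequence `η n` of success probabilities:
the upper limit of `-(1/n) log (1 - η n)` in `[-∞, ∞]`, with `log 0 = -∞`. It is the limit
whenever the limit exists. -/
def asymptoticRate (η : ℕ → ℝ≥0∞) : EReal :=
  limsup (fun n : ℕ => -(ENNReal.log (1 - η n)) / (n : EReal)) atTop

section Rates

variable {ι : Type*} [Fintype ι] [DecidableEq ι]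

/-- The Bayesian rate `R*(δ, μ, ρ)` for `n → ∞` copies `ρ(t)^{⊗ n}`. -/
def bayesRate (δ : ℝ) (μ : Measure ℝ) (ρ : ℝ → Matrix ι ι ℂ) : EReal :=
  asymptoticRate fun n => optBayesSuccess δ μ fun t => tensorPower n (ρ t)

/-- The minimax rate for `n → ∞` copies `ρ(t)^{⊗ n}` and the parameter domain `Θ`. -/
def minimaxRate (δ : ℝ) (Θ : Set ℝ) (ρ : ℝ → Matrix ι ι ℂ) : EReal :=
  asymptoticRate fun n => optMinimaxSuccess δ Θ fun t => tensorPower n (ρ t)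

/-- The real power `ρ ^ s` (`0 ≤ s`) of a positive semidefinite matrix, by functional calculus.
At `s = 0` this is the identity; the value of `chernoff` would be the same with the support
projection instead, which is the limit of `ρ ^ s` for `s → 0+`. -/
def matPow (ρ : Matrix ι ι ℂ) (s : ℝ) : Matrix ι ι ℂ :=
  cfc (fun x : ℝ => x ^ s) ρ

/-- The quantum Chernoff divergence `C(ρ, σ) = - inf_{0 ≤ s ≤ 1} log Tr[ρ^s σ^{1-s}]`,
with values in `[-∞, ∞]` (it is `∞` for orthogonal states). -/
def chernoff (ρ σ : Matrix ι ι ℂ) : EReal :=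
  -⨅ s ∈ Set.Icc (0 : ℝ) 1,
    ENNReal.log (ENNReal.ofReal (matPow ρ s * matPow σ (1 - s)).trace.re)

/-- The infimum of `C(ρ(t), ρ(t'))` over `t, t' ∈ S` with `|t - t'| > 2δ`
(it is `∞` if there is no such pair). -/
def infChernoff (δ : ℝ) (S : Set ℝ) (ρ : ℝ → Matrix ι ι ℂ) : EReal :=
  ⨅ (t ∈ S) (t' ∈ S) (_ : 2 * δ < |t - t'|), chernoff (ρ t) (ρ t')

end Rates

end PACMetrology

end

noncomputable section

namespace PACMetrology

/-! ### Classical Chernoff lower bound -/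

/-! If `|t - t'| > 2δ`, the tolerance intervals of `t` and `t'` are disjoint, so every estimator is
also a test between the two states: its two success probabilities add up to at most 2 minus a test
error (`hitProb_add_hitProb_add_le`). By the converse quantum Chernoff bound
(`ChernoffLE.eventually_test_error`) that error is at least `½ exp (-n (C + ε))` for large `n`. It
follows from the Nussbaum-Szkoła reduction to classical weights and the classical bound
`eventually_exp_le_overlap`. For the minimax rate one pair of parameters is enough.

The prior may give single pairs no mass, so the Bayesian rate needs a set of bad pairs of positive
`μ × μ` measure. The divergence is upper semicontinuous (`ChernoffLE.eventually_nhdsWithin`), so all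
pairs whose parameters and states are near those of `(t, t')` are almost as hard to discriminate.
They have positive mass if `t` and `t'` are essential values, i.e. `μ` charges every neighbourhood
of their points in the graph of `ρ`. Almost every value is essential (`measure_not_isEssential`); if
`ρ` is continuous on `Θ`, so is every support point in `Θ`. The mass of the bad pairs enters the
error only as a constant factor, invisible to the rate. -/

theorem eventually_lt_of_hasDerivAt_neg {f : ℝ → ℝ} {f' x : ℝ} (hf : HasDerivAt f f' x)
    (h : f' < 0) : ∀ᶠ y in 𝓝[>] x, f y < f x := by
  have h1 := (hasDerivAt_iff_tendsto_slope.1 hf).eventually (gt_mem_nhds h)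
  have h2 : ∀ᶠ y in 𝓝[>] x, slope f x y < 0 :=
    h1.filter_mono (nhdsWithin_mono _ fun y hy => ne_of_gt hy)
  filter_upwards [h2, self_mem_nhdsWithin] with y hy hxy
  have hxy' : 0 < y - x := sub_pos.2 hxy
  rw [slope_def_field, div_neg_iff] at hy
  rcases hy with hy | hy <;> linarith

/-- The Chernoff sum `∑ p ^ s * q ^ (1 - s)`. -/
def chernoffSum {X : Type*} [Fintype X] (p q : X → ℝ) (s : ℝ) : ℝ :=
  ∑ x, p x ^ s * q x ^ (1 - s)

/-- The overlap `∑ min (p, q)` of two `n`-fold product weights. -/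
def overlap {X : Type*} [Fintype X] (p q : X → ℝ) (n : ℕ) : ℝ :=
  ∑ z : Fin n → X, min (∏ i, p (z i)) (∏ i, q (z i))

section Classical

variable {X : Type*} [Fintype X] {p q : X → ℝ}

theorem differentiable_chernoffSum (hp : ∀ x, 0 < p x) (hq : ∀ x, 0 < q x) :
    Differentiable ℝ (chernoffSum p q) := by
  unfold chernoffSum
  intro s
  refine DifferentiableAt.fun_sum fun x _ => ?_
  refine DifferentiableAt.mul ?_ ?_
  · exact (differentiableAt_const _).rpow differentiableAt_id (hp x).ne'
  · exact (differentiableAt_const _).rpow ((differentiableAt_const _).sub differentiableAt_id)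
      (hq x).ne'

theorem chernoffSum_pow (hp : ∀ x, 0 < p x) (hq : ∀ x, 0 < q x) (s : ℝ) (n : ℕ) :
    chernoffSum p q s ^ n =
      ∑ z : Fin n → X, (∏ i, p (z i)) ^ s * (∏ i, q (z i)) ^ (1 - s) := by
  unfold chernoffSum
  rw [Fintype.sum_pow]
  refine Finset.sum_congr rfl fun z _ => ?_
  rw [Finset.prod_mul_distrib, Real.finsetProd_rpow _ _ fun i _ => (hp _).le,
    Real.finsetProd_rpow _ _ fun i _ => (hq _).le]

/-- The left side is `Q (P/Q) ^ s`. Either `(P/Q) ^ s ≤ exp E`, or `P/Q ≥ exp E` and shifting the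
exponent by `θ` gains at least `exp (θ E)`. For `s = 0` the second case is empty; dropping its term
matters later, when the minimiser is an endpoint. -/
theorem rpow_mul_rpow_le_of_le {P Q s E θ : ℝ} (hP : 0 < P) (hQ : 0 < Q) (hs : 0 ≤ s) (hs1 : s ≤ 1)
    (hE : 0 ≤ E) (hθ : 0 < θ) (hPQ : Q ≤ P) :
    P ^ s * Q ^ (1 - s) ≤ min P Q * Real.exp E +
      (if s = 0 then 0 else Real.exp (-(θ * E)) * (P ^ (s + θ) * Q ^ (1 - (s + θ)))) := by
  obtain ⟨a, rfl⟩ : ∃ a, P = Real.exp a := ⟨_, (Real.exp_log hP).symm⟩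
  obtain ⟨b, rfl⟩ : ∃ a, Q = Real.exp a := ⟨_, (Real.exp_log hQ).symm⟩
  have hab : b ≤ a := Real.exp_le_exp.1 hPQ
  rw [min_eq_right hPQ]
  simp only [← Real.exp_mul, ← Real.exp_add]
  have h0 : 0 ≤ if s = 0 then 0 else
      Real.exp (-(θ * E) + (a * (s + θ) + b * (1 - (s + θ)))) := by
    split_ifs
    · exact le_rfl
    · positivity
  by_cases hW : s * (a - b) ≤ E
  · have : Real.exp (a * s + b * (1 - s)) ≤ Real.exp (b + E) := by
      apply Real.exp_le_exp.2; nlinarith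
    linarith
  · push Not at hW
    have hs0 : s ≠ 0 := by rintro rfl; simp at hW; linarith
    rw [if_neg hs0]
    have hW' : E ≤ a - b := by nlinarith
    have : Real.exp (a * s + b * (1 - s)) ≤
        Real.exp (-(θ * E) + (a * (s + θ) + b * (1 - (s + θ)))) := by
      apply Real.exp_le_exp.2; nlinarith
    have := Real.exp_pos (b + E)
    linarith

theorem rpow_mul_rpow_le {P Q s E θ : ℝ} (hP : 0 < P) (hQ : 0 < Q) (hs : 0 ≤ s) (hs1 : s ≤ 1)
    (hE : 0 ≤ E) (hθ : 0 < θ) :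
    P ^ s * Q ^ (1 - s) ≤ min P Q * Real.exp E +
      ((if s = 0 then 0 else Real.exp (-(θ * E)) * (P ^ (s + θ) * Q ^ (1 - (s + θ)))) +
      (if s = 1 then 0 else Real.exp (-(θ * E)) * (P ^ (s - θ) * Q ^ (1 - (s - θ))))) := by
  rcases le_total Q P with h | h
  · have h1 := rpow_mul_rpow_le_of_le hP hQ hs hs1 hE hθ h
    have : 0 ≤ if s = 1 then 0 else Real.exp (-(θ * E)) * (P ^ (s - θ) * Q ^ (1 - (s - θ))) := by
      split_ifs
      · exact le_rfl
      · positivity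
    linarith
  · have h1 := rpow_mul_rpow_le_of_le (s := 1 - s) hQ hP (by linarith) (by linarith) hE hθ h
    have : 0 ≤ if s = 0 then 0 else Real.exp (-(θ * E)) * (P ^ (s + θ) * Q ^ (1 - (s + θ))) := by
      split_ifs
      · exact le_rfl
      · positivity
    rw [show 1 - (1 - s) = s by ring, show 1 - (1 - s + θ) = s - θ by ring,
      show 1 - s + θ = 1 - (s - θ) by ring, min_comm, mul_comm (Q ^ (1 - s)),
      mul_comm (Q ^ (1 - (s - θ)))] at h1
    have h2 : (1 - s = 0) ↔ s = 1 := by constructor <;> intro h <;> linarith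
    simp only [h2] at h1
    linarith

theorem chernoffSum_pow_le_overlap (hp : ∀ x, 0 < p x) (hq : ∀ x, 0 < q x) {s ε θ : ℝ}
    (hs : 0 ≤ s) (hs1 : s ≤ 1) (hε : 0 ≤ ε) (hθ : 0 < θ) (n : ℕ) :
    chernoffSum p q s ^ n ≤ overlap p q n * Real.exp (n * ε) +
      ((if s = 0 then 0 else (Real.exp (-(θ * ε)) * chernoffSum p q (s + θ)) ^ n) +
      (if s = 1 then 0 else (Real.exp (-(θ * ε)) * chernoffSum p q (s - θ)) ^ n)) := by
  have hexp : Real.exp (-(θ * ε)) ^ n = Real.exp (-(θ * (n * ε))) := by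
    rw [← Real.exp_nat_mul]; ring_nf
  simp only [mul_pow, chernoffSum_pow hp hq, hexp]
  have key : ∀ z : Fin n → X, _ := fun z => rpow_mul_rpow_le (P := ∏ i, p (z i))
    (Q := ∏ i, q (z i)) (s := s) (E := n * ε) (θ := θ) (Finset.prod_pos fun i _ => hp _)
    (Finset.prod_pos fun i _ => hq _) hs hs1 (by positivity) hθ
  refine (Finset.sum_le_sum fun z _ => key z).trans (le_of_eq ?_)
  rw [Finset.sum_add_distrib, Finset.sum_add_distrib, overlap, Finset.sum_mul]
  congr 2
  · split_ifs
    · simp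
    · rw [Finset.mul_sum]
  · split_ifs
    · simp
    · rw [Finset.mul_sum]

/-- First-order condition at a minimiser on `[0, 1]`: the derivative is `≤ 0` unless `s = 0` and `≥
0` unless `s = 1`. The factor `exp (-(θ ε))` adds slope `-ε Z(s) < 0`, making the decrease strict.
Hence the tail terms of `chernoffSum_pow_le_overlap` are exponentially smaller than its left side.
-/
theorem exists_tilt_lt (hp : ∀ x, 0 < p x) (hq : ∀ x, 0 < q x) {s ε : ℝ}
    (hs : s ∈ Set.Icc (0 : ℝ) 1) (hmin : ∀ r ∈ Set.Icc (0 : ℝ) 1, chernoffSum p q s ≤ chernoffSum p q r)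
    (hZ : 0 < chernoffSum p q s) (hε : 0 < ε) :
    ∃ θ > 0, (s ≠ 0 → Real.exp (-(θ * ε)) * chernoffSum p q (s + θ) < chernoffSum p q s) ∧
      (s ≠ 1 → Real.exp (-(θ * ε)) * chernoffSum p q (s - θ) < chernoffSum p q s) := by
  have hd := (differentiable_chernoffSum hp hq s).hasDerivAt
  set Z := chernoffSum p q with hZdef
  set D := deriv Z s with hD
  have hplus : HasDerivAt (fun θ => Z (s + θ)) D 0 := by
    have := HasDerivAt.comp_const_add s 0 (f := Z) (f' := D) (by simpa using hd)
    simpa using this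
  have hminus : HasDerivAt (fun θ => Z (s - θ)) (-D) 0 := by
    have := HasDerivAt.comp_const_sub s 0 (f := Z) (f' := D) (by simpa using hd)
    simpa using this
  have hexp : HasDerivAt (fun θ => Real.exp (-(θ * ε))) (-ε) 0 := by
    have := ((hasDerivAt_id (0 : ℝ)).mul_const ε).neg.exp
    simpa using this
  have hD0 : s ≠ 0 → D ≤ 0 := by
    intro hs0
    by_contra hneg
    push Not at hneg
    have h1 := eventually_lt_of_hasDerivAt_neg hminus (by linarith)
    have hspos : 0 < s := lt_of_le_of_ne hs.1 (Ne.symm hs0)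
    have h2 : ∀ᶠ θ in 𝓝[>] (0 : ℝ), θ < s := nhdsWithin_le_nhds (gt_mem_nhds hspos)
    obtain ⟨θ, ⟨h3, h4⟩, h5⟩ := ((h1.and h2).and self_mem_nhdsWithin).exists
    have h5 : 0 < θ := h5
    have := hmin (s - θ) ⟨by linarith, by linarith [hs.2]⟩
    simp only [sub_zero] at h3
    linarith
  have hD1 : s ≠ 1 → 0 ≤ D := by
    intro hs0
    by_contra hneg
    push Not at hneg
    have h1 := eventually_lt_of_hasDerivAt_neg hplus hneg
    have hspos : 0 < 1 - s := sub_pos.2 (lt_of_le_of_ne hs.2 hs0)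
    have h2 : ∀ᶠ θ in 𝓝[>] (0 : ℝ), θ < 1 - s := nhdsWithin_le_nhds (gt_mem_nhds hspos)
    obtain ⟨θ, ⟨h3, h4⟩, h5⟩ := ((h1.and h2).and self_mem_nhdsWithin).exists
    have h5 : 0 < θ := h5
    have := hmin (s + θ) ⟨by linarith [hs.1], by linarith⟩
    simp only [add_zero] at h3
    linarith
  have e1 : ∀ᶠ θ in 𝓝[>] (0 : ℝ), s ≠ 0 → Real.exp (-(θ * ε)) * Z (s + θ) < Z s := by
    by_cases hs0 : s = 0
    · simp [hs0]
    · have h := eventually_lt_of_hasDerivAt_neg (hexp.mul hplus) (by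
        have := hD0 hs0
        simp only [zero_mul, neg_zero, Real.exp_zero, add_zero]
        nlinarith)
      filter_upwards [h] with θ hθ _
      simpa using hθ
  have e2 : ∀ᶠ θ in 𝓝[>] (0 : ℝ), s ≠ 1 → Real.exp (-(θ * ε)) * Z (s - θ) < Z s := by
    by_cases hs0 : s = 1
    · simp [hs0]
    · have h := eventually_lt_of_hasDerivAt_neg (hexp.mul hminus) (by
        have := hD1 hs0
        simp only [zero_mul, neg_zero, Real.exp_zero, sub_zero]
        nlinarith)
      filter_upwards [h] with θ hθ _
      simpa using hθ
  obtain ⟨θ, ⟨h3, h4⟩, h5⟩ := ((e1.and e2).and self_mem_nhdsWithin).exists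
  exact ⟨θ, h5, h3, h4⟩

theorem eventually_exp_le_overlap_of_pos (hp : ∀ x, 0 < p x) (hq : ∀ x, 0 < q x) {c c' : ℝ}
    (hc : c < c') (h : ∀ s ∈ Set.Icc (0 : ℝ) 1, Real.exp (-c) ≤ chernoffSum p q s) :
    ∀ᶠ n : ℕ in atTop, Real.exp (-(n * c')) ≤ overlap p q n := by
  obtain ⟨s, hs, hmin⟩ := isCompact_Icc.exists_isMinOn (Set.nonempty_Icc.2 (zero_le_one' ℝ))
    (differentiable_chernoffSum hp hq).continuous.continuousOn
  have hmin' : ∀ r ∈ Set.Icc (0 : ℝ) 1, chernoffSum p q s ≤ chernoffSum p q r :=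
    fun r hr => hmin hr
  have hZ : 0 < chernoffSum p q s := (Real.exp_pos _).trans_le (h s hs)
  -- Half of the gap pays for the factor `exp (n ε)` in front of the overlap, the other half for the
  -- constant `1 / 2` left after removing both tails.
  set ε := (c' - c) / 2 with hεdef
  have hε : 0 < ε := by simp only [hεdef]; linarith
  obtain ⟨θ, hθ, h1, h2⟩ := exists_tilt_lt hp hq hs hmin' hZ hε
  have hnn : ∀ r, 0 ≤ chernoffSum p q r := fun r => Finset.sum_nonneg fun x _ =>
    mul_nonneg (Real.rpow_nonneg (hp x).le _) (Real.rpow_nonneg (hq x).le _)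
  have key : ∀ κ : ℝ, 0 ≤ κ → κ < chernoffSum p q s →
      ∀ᶠ n : ℕ in atTop, κ ^ n ≤ 1 / 4 * chernoffSum p q s ^ n := by
    intro κ hκ hκZ
    have := tendsto_pow_atTop_nhds_zero_of_lt_one (div_nonneg hκ hZ.le) ((div_lt_one hZ).2 hκZ)
    filter_upwards [this.eventually (gt_mem_nhds (show (0 : ℝ) < 1 / 4 by norm_num))] with n hn
    rw [div_pow, div_lt_iff₀ (pow_pos hZ n)] at hn
    exact hn.le
  have k1 : ∀ᶠ n : ℕ in atTop, (if s = 0 then 0 else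
      (Real.exp (-(θ * ε)) * chernoffSum p q (s + θ)) ^ n) ≤ 1 / 4 * chernoffSum p q s ^ n := by
    by_cases hs0 : s = 0
    · simp only [hs0, if_true]
      exact Eventually.of_forall fun n => mul_nonneg (by norm_num) (pow_nonneg (hnn _) n)
    · simp only [hs0, if_false]
      exact key _ (mul_nonneg (Real.exp_pos _).le (hnn _)) (h1 hs0)
  have k2 : ∀ᶠ n : ℕ in atTop, (if s = 1 then 0 else
      (Real.exp (-(θ * ε)) * chernoffSum p q (s - θ)) ^ n) ≤ 1 / 4 * chernoffSum p q s ^ n := by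
    by_cases hs0 : s = 1
    · simp only [hs0, if_true]
      exact Eventually.of_forall fun n => mul_nonneg (by norm_num) (pow_nonneg (hnn _) n)
    · simp only [hs0, if_false]
      exact key _ (mul_nonneg (Real.exp_pos _).le (hnn _)) (h2 hs0)
  have k3 : ∀ᶠ n : ℕ in atTop, Real.exp (-ε) ^ n < 1 / 2 :=
    (tendsto_pow_atTop_nhds_zero_of_lt_one (Real.exp_pos _).le
      (Real.exp_lt_one_iff.2 (by linarith))).eventually (gt_mem_nhds (by norm_num))
  filter_upwards [k1, k2, k3] with n h1 h2 h3
  have h4 := chernoffSum_pow_le_overlap hp hq hs.1 hs.2 hε.le hθ n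
  have h5 : 1 / 2 * chernoffSum p q s ^ n ≤ overlap p q n * Real.exp (n * ε) := by linarith
  have h6 : Real.exp (-c) ^ n ≤ chernoffSum p q s ^ n :=
    pow_le_pow_left₀ (Real.exp_pos _).le (h s hs) n
  rw [← Real.exp_nat_mul] at h3 h6
  have h7 : Real.exp (-(n * c')) * Real.exp (n * ε) = Real.exp (n * -ε) * Real.exp (n * -c) := by
    rw [← Real.exp_add, ← Real.exp_add]
    congr 1
    simp only [hεdef]; ring
  refine le_of_mul_le_mul_right ?_ (Real.exp_pos (n * ε))
  rw [h7]
  have := Real.exp_pos (n * -c)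
  nlinarith

theorem overlap_subtype_le (hp : ∀ x, 0 ≤ p x) (hq : ∀ x, 0 ≤ q x) (S : X → Prop) [DecidablePred S]
    (n : ℕ) :
    overlap (fun x : {x // S x} => p x) (fun x : {x // S x} => q x) n ≤ overlap p q n := by
  classical
  unfold overlap
  have hinj : Function.Injective fun (z : Fin n → {x // S x}) (i : Fin n) => (z i : X) :=
    fun z z' h => funext fun i => Subtype.ext (congrFun h i)
  refine (Finset.sum_map Finset.univ ⟨_, hinj⟩
    fun z : Fin n → X => min (∏ i, p (z i)) (∏ i, q (z i))).symm.trans_le ?_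
  exact Finset.sum_le_sum_of_subset_of_nonneg (Finset.subset_univ _) fun z _ _ =>
    le_min (Finset.prod_nonneg fun i _ => hp _) (Finset.prod_nonneg fun i _ => hq _)

/-- For `0 < s < 1` only the common support contributes. There all weights are positive, the sum is
continuous in `s`, and the bound extends to the endpoints by closure. -/
theorem eventually_exp_le_overlap (hp : ∀ x, 0 ≤ p x) (hq : ∀ x, 0 ≤ q x) {c c' : ℝ}
    (hc : c < c')
    (h : ∀ s ∈ Set.Ioo (0 : ℝ) 1, Real.exp (-c) ≤ chernoffSum p q s) :
    ∀ᶠ n : ℕ in atTop, Real.exp (-(n * c')) ≤ overlap p q n := by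
  classical
  let S : X → Prop := fun x => 0 < p x ∧ 0 < q x
  let p' : {x // S x} → ℝ := fun x => p x
  let q' : {x // S x} → ℝ := fun x => q x
  have hp' : ∀ x, 0 < p' x := fun x => x.2.1
  have hq' : ∀ x, 0 < q' x := fun x => x.2.2
  have heq : ∀ s ∈ Set.Ioo (0 : ℝ) 1, chernoffSum p' q' s = chernoffSum p q s := by
    intro s hs
    unfold chernoffSum
    refine (Finset.sum_subtype (Finset.univ.filter S) (by simp)
      fun x => p x ^ s * q x ^ (1 - s)).symm.trans
      (Finset.sum_subset (Finset.filter_subset _ _) fun x _ hx => ?_)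
    have hs1 : 1 - s ≠ 0 := (sub_pos.2 hs.2).ne'
    rw [Finset.mem_filter_univ, not_and_or, not_lt, not_lt] at hx
    rcases hx with hx | hx
    · rw [le_antisymm hx (hp x), Real.zero_rpow hs.1.ne', zero_mul]
    · rw [le_antisymm hx (hq x), Real.zero_rpow hs1, mul_zero]
  have hmem : ∀ s ∈ Set.Icc (0 : ℝ) 1, Real.exp (-c) ≤ chernoffSum p' q' s := by
    have hcl : IsClosed {s | Real.exp (-c) ≤ chernoffSum p' q' s} :=
      isClosed_le continuous_const (differentiable_chernoffSum hp' hq').continuous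
    have hsub : Set.Ioo (0 : ℝ) 1 ⊆ {s | Real.exp (-c) ≤ chernoffSum p' q' s} :=
      fun s hs => (h s hs).trans_eq (heq s hs).symm
    have := hcl.closure_subset_iff.2 hsub
    rw [closure_Ioo (zero_ne_one' ℝ)] at this
    exact fun s hs => this hs
  filter_upwards [eventually_exp_le_overlap_of_pos hp' hq' hc hmem] with n hn
  exact hn.trans (overlap_subtype_le hp hq S n)

/-- A uniform lower bound on all tilted sums is witnessed, up to a small loss, by finitely many
sums whose two exponents are both positive. -/
theorem exists_mesh_exp_lt {w : X → ℝ} (hp : ∀ x, 0 ≤ p x) (hq : ∀ x, 0 ≤ q x) {c c' : ℝ}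
    (hc : c < c')
    (h : ∀ s ∈ Set.Ioo (0 : ℝ) 1, Real.exp (-c) ≤ ∑ x, p x ^ s * q x ^ (1 - s) * w x) :
    ∃ K : ℕ, 0 < K ∧ ∀ k < K,
      Real.exp (-c') < ∑ x, p x ^ ((k + 1 : ℝ) / K) * q x ^ (1 - (k : ℝ) / K) * w x := by
  classical
  let S : Finset X := Finset.univ.filter fun x => 0 < p x ∧ 0 < q x
  -- The two exponents are decoupled: uniform continuity of `G` on the square allows a step from the
  -- diagonal `(k/K, k/K)` to `(k/K, (k+1)/K)` at small loss.
  let G : ℝ × ℝ → ℝ := fun r => ∑ x ∈ S, p x ^ r.2 * q x ^ (1 - r.1) * w x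
  have hG : Continuous G := by
    refine continuous_finsetSum _ fun x hx => ?_
    have hx' := (Finset.mem_filter_univ x).1 hx
    exact (((Real.continuous_const_rpow hx'.1.ne').comp continuous_snd).mul
      ((Real.continuous_const_rpow hx'.2.ne').comp (continuous_const.sub continuous_fst))).mul
      continuous_const
  have heq : ∀ a b : ℝ, a < 1 → 0 < b → G (a, b) = ∑ x, p x ^ b * q x ^ (1 - a) * w x := by
    intro a b ha hb
    refine Finset.sum_subset (Finset.subset_univ _) fun x _ hx => ?_
    rw [Finset.mem_filter_univ, not_and_or, not_lt, not_lt] at hx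
    rcases hx with hx | hx
    · rw [le_antisymm hx (hp x), Real.zero_rpow hb.ne', zero_mul, zero_mul]
    · rw [le_antisymm hx (hq x), Real.zero_rpow (sub_pos.2 ha).ne', mul_zero, zero_mul]
  have hdiag : ∀ s ∈ Set.Icc (0 : ℝ) 1, Real.exp (-c) ≤ G (s, s) := by
    have hcl : IsClosed {s | Real.exp (-c) ≤ G (s, s)} :=
      isClosed_le continuous_const (hG.comp (continuous_id.prodMk continuous_id))
    have hsub : Set.Ioo (0 : ℝ) 1 ⊆ {s | Real.exp (-c) ≤ G (s, s)} :=
      fun s hs => (h s hs).trans_eq (heq s s hs.2 hs.1).symm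
    have := hcl.closure_subset_iff.2 hsub
    rw [closure_Ioo (zero_ne_one' ℝ)] at this
    exact fun s hs => this hs
  have huc := (isCompact_Icc.prod isCompact_Icc :
    IsCompact (Set.Icc (0 : ℝ) 1 ×ˢ Set.Icc (0 : ℝ) 1)).uniformContinuousOn_of_continuous
    hG.continuousOn
  rw [Metric.uniformContinuousOn_iff] at huc
  obtain ⟨d, hd, hdG⟩ := huc (Real.exp (-c) - Real.exp (-c'))
    (sub_pos.2 (Real.exp_lt_exp.2 (neg_lt_neg hc)))
  obtain ⟨m, hm⟩ := exists_nat_one_div_lt hd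
  refine ⟨m + 1, m.succ_pos, fun k hk => ?_⟩
  have hm0 : (0 : ℝ) < ((m + 1 : ℕ) : ℝ) := by positivity
  have hk1 : (k : ℝ) + 1 ≤ ((m + 1 : ℕ) : ℝ) := by exact_mod_cast hk
  have ha : (k : ℝ) / ((m + 1 : ℕ) : ℝ) ∈ Set.Icc (0 : ℝ) 1 :=
    ⟨by positivity, (div_le_one hm0).2 (by linarith)⟩
  have hb : ((k : ℝ) + 1) / ((m + 1 : ℕ) : ℝ) ∈ Set.Icc (0 : ℝ) 1 :=
    ⟨by positivity, (div_le_one hm0).2 hk1⟩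
  rw [← heq _ _ ((div_lt_one hm0).2 (by linarith)) (by positivity)]
  have hlt := hdG (k / ((m + 1 : ℕ) : ℝ), (k + 1) / ((m + 1 : ℕ) : ℝ)) ⟨ha, hb⟩
    (k / ((m + 1 : ℕ) : ℝ), k / ((m + 1 : ℕ) : ℝ)) ⟨ha, ha⟩ (by
      rw [Prod.dist_eq, dist_self, Real.dist_eq, ← sub_div, add_sub_cancel_left,
        abs_of_pos (by positivity), max_eq_right (by positivity)]
      exact_mod_cast hm)
  rw [Real.dist_eq, abs_lt] at hlt
  have := hdiag _ ha
  linarith [hlt.1]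

end Classical

end PACMetrology

end

noncomputable section

namespace PACMetrology

open scoped ComplexOrder

open Matrix

/-! ### Traces in spectral form and the Nussbaum-Szkoła bound -/

section Trace

variable {κ : Type*} [Fintype κ] [DecidableEq κ]

/-- `U diag(a) U†`. -/
def conjDiag (U : Matrix κ κ ℂ) (a : κ → ℝ) : Matrix κ κ ℂ :=
  U * diagonal (fun x => (a x : ℂ)) * Uᴴ

theorem re_trace_diagonal_mul (a b : κ → ℝ) (M : Matrix κ κ ℂ) :
    (diagonal (fun x => (a x : ℂ)) * (M * diagonal (fun y => (b y : ℂ)) * Mᴴ)).trace.re =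
      ∑ x, ∑ y, a x * b y * ‖M x y‖ ^ 2 := by
  simp only [Matrix.trace, Matrix.diag_apply, Matrix.diagonal_mul]
  simp only [Matrix.mul_apply (M := M * diagonal _), Matrix.mul_diagonal,
    Matrix.conjTranspose_apply, Complex.re_sum, Finset.mul_sum]
  refine Finset.sum_congr rfl fun x _ => Finset.sum_congr rfl fun y _ => ?_
  have h : M x y * star (M x y) = ((‖M x y‖ ^ 2 : ℝ) : ℂ) := by
    rw [Complex.star_def, Complex.mul_conj, Complex.normSq_eq_norm_sq]
  rw [mul_right_comm, h, ← Complex.ofReal_mul, ← Complex.ofReal_mul, Complex.ofReal_re, mul_right_comm,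
    ← mul_assoc, mul_right_comm]

theorem re_trace_conjDiag_mul (U V : Matrix κ κ ℂ) (a b : κ → ℝ) :
    (conjDiag U a * conjDiag V b).trace.re = ∑ x, ∑ y, a x * b y * ‖(Uᴴ * V) x y‖ ^ 2 := by
  rw [← re_trace_diagonal_mul, conjDiag, conjDiag, mul_assoc U, Matrix.mul_assoc, Matrix.trace_mul_comm,
    Matrix.conjTranspose_mul, Matrix.conjTranspose_conjTranspose]
  simp only [Matrix.mul_assoc]

theorem re_trace_conjDiag_mul_mul_conjTranspose (U V B : Matrix κ κ ℂ) (hV : V * Vᴴ = 1)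
    (a : κ → ℝ) :
    (conjDiag U a * (B * Bᴴ)).trace.re = ∑ x, ∑ y, a x * ‖(Uᴴ * B * V) x y‖ ^ 2 := by
  have h := re_trace_diagonal_mul a (fun _ => 1) (Uᴴ * B * V)
  simp only [mul_one] at h
  rw [← h, conjDiag, mul_assoc U, Matrix.mul_assoc, Matrix.trace_mul_comm]
  simp only [Complex.ofReal_one, Matrix.diagonal_one, mul_one, Matrix.conjTranspose_mul,
    Matrix.conjTranspose_conjTranspose]
  have : Uᴴ * B * V * (Vᴴ * (Bᴴ * U)) = Uᴴ * (B * Bᴴ) * U := by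
    calc _ = Uᴴ * B * (V * Vᴴ) * (Bᴴ * U) := by simp only [Matrix.mul_assoc]
      _ = _ := by rw [hV, mul_one]; simp only [Matrix.mul_assoc]
  rw [this]
  simp only [Matrix.mul_assoc]

open scoped MatrixOrder Matrix.Norms.L2Operator in
theorem re_trace_mul_nonneg {A B : Matrix κ κ ℂ} (hA : A.PosSemidef) (hB : B.PosSemidef) :
    0 ≤ (A * B).trace.re := by
  obtain ⟨C, rfl⟩ := CStarAlgebra.nonneg_iff_eq_star_mul_self.1 hA.nonneg
  rw [mul_assoc, Matrix.trace_mul_comm]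
  exact (Complex.le_def.1 (hB.mul_mul_conjTranspose_same C).trace_nonneg).1

/-- `A - A² = A (1 - A) A + (1 - A) A (1 - A)`. This allows an effect to be replaced by its square,
as if it were a projection. -/
theorem posSemidef_sub_mul_self {A : Matrix κ κ ℂ} (hA : A.PosSemidef) (hA1 : (1 - A).PosSemidef) :
    (A - A * A).PosSemidef := by
  have h1 : (A * (1 - A) * Aᴴ).PosSemidef := hA1.mul_mul_conjTranspose_same A
  have h2 : ((1 - A) * A * (1 - A)ᴴ).PosSemidef := hA.mul_mul_conjTranspose_same (1 - A)
  rw [hA.1.eq] at h1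
  rw [hA1.1.eq] at h2
  convert! h1.add h2 using 1
  noncomm_ring

/-- **Nussbaum-Szkoła bound**: the error of a binary test between two positive matrices
is at least half the overlap of their spectral weights. -/
theorem half_overlap_le_test_error {U V A : Matrix κ κ ℂ} {a b : κ → ℝ}
    (hU : U * Uᴴ = 1) (hV : V * Vᴴ = 1) (ha : ∀ x, 0 ≤ a x) (hb : ∀ x, 0 ≤ b x)
    (hA : A.PosSemidef) (hA1 : (1 - A).PosSemidef) :
    1 / 2 * ∑ x, ∑ y, ‖(Uᴴ * V) x y‖ ^ 2 * min (a x) (b y) ≤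
      (conjDiag U a * (1 - A)).trace.re + (conjDiag V b * A).trace.re := by
  have hcd : ∀ (W : Matrix κ κ ℂ) (d : κ → ℝ), (∀ x, 0 ≤ d x) → (conjDiag W d).PosSemidef := by
    intro W d hd
    refine PosSemidef.mul_mul_conjTranspose_same (PosSemidef.diagonal ?_) W
    intro x
    simpa using hd x
  have key : ∀ (W B : Matrix κ κ ℂ) (d : κ → ℝ), (∀ x, 0 ≤ d x) → B.PosSemidef →
      (1 - B).PosSemidef → (conjDiag W d * (B * Bᴴ)).trace.re ≤ (conjDiag W d * B).trace.re := by
    intro W B d hd hB hB1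
    have := re_trace_mul_nonneg (hcd W d hd) (posSemidef_sub_mul_self hB hB1)
    rw [Matrix.mul_sub, Matrix.trace_sub, Complex.sub_re] at this
    rw [hB.1.eq]
    linarith
  have h1 := key U (1 - A) a ha hA1 (by simpa using hA)
  have h2 := key V A b hb hA hA1
  rw [re_trace_conjDiag_mul_mul_conjTranspose U V _ hV] at h1
  rw [re_trace_conjDiag_mul_mul_conjTranspose V U _ hU] at h2
  refine le_trans ?_ (add_le_add h1 h2)
  rw [Finset.sum_comm (f := fun x y => b x * ‖(Vᴴ * A * U) x y‖ ^ 2), ← Finset.sum_add_distrib,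
    Finset.mul_sum]
  refine Finset.sum_le_sum fun x _ => ?_
  rw [← Finset.sum_add_distrib, Finset.mul_sum]
  refine Finset.sum_le_sum fun y _ => ?_
  have h3 : ‖(Vᴴ * A * U) y x‖ = ‖(Uᴴ * A * V) x y‖ := by
    have : (Vᴴ * A * U) = (Uᴴ * A * V)ᴴ := by
      simp only [Matrix.conjTranspose_mul, Matrix.conjTranspose_conjTranspose, hA.1.eq,
        Matrix.mul_assoc]
    rw [this, Matrix.conjTranspose_apply, norm_star]
  -- The amplitude splits along `1 = (1 - A) + A`; `(u + v)² ≤ 2 (u² + v²)` is the source of the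
  -- factor `1 / 2`.
  have h4 : ‖(Uᴴ * V) x y‖ ≤ ‖(Uᴴ * (1 - A) * V) x y‖ + ‖(Uᴴ * A * V) x y‖ := by
    have : Uᴴ * V = Uᴴ * (1 - A) * V + Uᴴ * A * V := by noncomm_ring
    rw [this, Matrix.add_apply]
    exact norm_add_le _ _
  rw [h3]
  set u := ‖(Uᴴ * (1 - A) * V) x y‖
  set v := ‖(Uᴴ * A * V) x y‖
  set m := min (a x) (b y)
  have hm0 : 0 ≤ m := le_min (ha x) (hb y)
  have hma : m ≤ a x := min_le_left _ _
  have hmb : m ≤ b y := min_le_right _ _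
  have h5 : ‖(Uᴴ * V) x y‖ ^ 2 ≤ 2 * (u ^ 2 + v ^ 2) := by
    have := pow_le_pow_left₀ (norm_nonneg _) h4 2
    nlinarith [sq_nonneg (u - v)]
  have h6 := mul_le_mul_of_nonneg_right h5 hm0
  have h7 := mul_le_mul_of_nonneg_right hma (sq_nonneg u)
  have h8 := mul_le_mul_of_nonneg_right hmb (sq_nonneg v)
  linarith

end Trace

/-! ### Tensor powers of matrices -/

section TensorPower

variable {ι : Type*}

theorem tensorPower_mul [Fintype ι] (n : ℕ) (A B : Matrix ι ι ℂ) :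
    tensorPower n (A * B) = tensorPower n A * tensorPower n B := by
  ext i j
  simp only [tensorPower, Matrix.of_apply, Matrix.mul_apply, Finset.prod_univ_sum,
    Fintype.piFinset_univ, Finset.prod_mul_distrib]

theorem tensorPower_conjTranspose (n : ℕ) (A : Matrix ι ι ℂ) :
    tensorPower n Aᴴ = (tensorPower n A)ᴴ := by
  ext i j
  simp [tensorPower, Matrix.conjTranspose_apply]

theorem tensorPower_diagonal [DecidableEq ι] (n : ℕ) (d : ι → ℂ) :
    tensorPower n (diagonal d) = diagonal fun z => ∏ k, d (z k) := by
  ext i j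
  by_cases h : i = j
  · subst h; simp [tensorPower]
  · rw [Matrix.diagonal_apply_ne _ h]
    obtain ⟨k, hk⟩ := Function.ne_iff.1 h
    exact Finset.prod_eq_zero (Finset.mem_univ k) (Matrix.diagonal_apply_ne _ hk)

theorem tensorPower_one [DecidableEq ι] (n : ℕ) : tensorPower n (1 : Matrix ι ι ℂ) = 1 := by
  rw [← Matrix.diagonal_one, tensorPower_diagonal]
  simp

theorem tensorPower_conjDiag [Fintype ι] [DecidableEq ι] (n : ℕ) (U : Matrix ι ι ℂ) (a : ι → ℝ) :
    tensorPower n (conjDiag U a) = conjDiag (tensorPower n U) fun z => ∏ k, a (z k) := by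
  simp only [conjDiag, tensorPower_mul, tensorPower_diagonal, tensorPower_conjTranspose,
    Complex.ofReal_prod]

theorem trace_tensorPower [Fintype ι] (n : ℕ) (A : Matrix ι ι ℂ) :
    (tensorPower n A).trace = A.trace ^ n := by
  simp only [Matrix.trace, Matrix.diag_apply, tensorPower, Matrix.of_apply]
  rw [Fintype.sum_pow]

end TensorPower

/-! ### States, their powers, and the converse quantum Chernoff bound -/

section States

variable {ι : Type*} [Fintype ι] [DecidableEq ι]

theorem IsState.exists_conjDiag {ρ : Matrix ι ι ℂ} (hρ : IsState ρ) :
    ∃ (U : Matrix ι ι ℂ) (a : ι → ℝ), U * Uᴴ = 1 ∧ (∀ x, 0 ≤ a x ∧ a x ≤ 1) ∧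
      ρ = conjDiag U a ∧ spectrum ℝ ρ = Set.range a ∧
      ∀ s, matPow ρ s = conjDiag U fun x => a x ^ s := by
  have hH := hρ.1.1
  have hsum : ∑ i, hH.eigenvalues i = 1 := by
    have := hH.trace_eq_sum_eigenvalues
    rw [hρ.2] at this
    exact RCLike.ofReal_injective (K := ℂ) (by simpa using this.symm)
  refine ⟨hH.eigenvectorUnitary, hH.eigenvalues, ?_, fun x => ⟨hρ.1.eigenvalues_nonneg x, ?_⟩,
    ?_, hH.spectrum_real_eq_range_eigenvalues, fun s => ?_⟩
  · exact Unitary.mul_star_self_of_mem hH.eigenvectorUnitary.2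
  · rw [← hsum]
    exact Finset.single_le_sum (fun i _ => hρ.1.eigenvalues_nonneg i) (Finset.mem_univ x)
  · conv_lhs => rw [hH.spectral_theorem]
    rfl
  · rw [matPow, hH.cfc_eq]
    rfl

theorem isState_tensorPower {ρ : Matrix ι ι ℂ} (hρ : IsState ρ) (n : ℕ) :
    IsState (tensorPower n ρ) := by
  obtain ⟨U, a, -, ha, hρ', -⟩ := hρ.exists_conjDiag
  refine ⟨?_, by rw [trace_tensorPower, hρ.2, one_pow]⟩
  rw [hρ', tensorPower_conjDiag]
  refine PosSemidef.mul_mul_conjTranspose_same (PosSemidef.diagonal fun x => ?_) _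
  exact Complex.zero_le_real.2 (Finset.prod_nonneg fun k _ => (ha _).1)

/-- All tilted overlaps `Tr[ρ ^ s σ ^ (1 - s)]` with `0 < s < 1` are at least `exp (-c)`. -/
def ChernoffLE (c : ℝ) (ρ σ : Matrix ι ι ℂ) : Prop :=
  ∀ s ∈ Set.Ioo (0 : ℝ) 1, Real.exp (-c) ≤ (matPow ρ s * matPow σ (1 - s)).trace.re

theorem chernoffLE_of_chernoff_lt {c : ℝ} {ρ σ : Matrix ι ι ℂ} (h : chernoff ρ σ < c) :
    ChernoffLE c ρ σ := by
  intro s hs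
  rw [chernoff, EReal.neg_lt_comm] at h
  have h1 := h.trans_le (iInf₂_le s (Set.Ioo_subset_Icc_self hs))
  rw [ENNReal.log_ofReal] at h1
  split_ifs at h1 with h0
  · exact absurd h1 not_lt_bot
  · rw [← EReal.coe_neg, EReal.coe_lt_coe_iff] at h1
    rw [← Real.exp_log (not_le.1 h0)]
    exact Real.exp_le_exp.2 h1.le

/-- Converse part of the quantum Chernoff bound: every test has an error of at least
`exp (-n (C + ε))`, for all large `n`. -/
theorem ChernoffLE.eventually_test_error {c c' : ℝ} {ρ σ : Matrix ι ι ℂ} (h : ChernoffLE c ρ σ)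
    (hρ : IsState ρ) (hσ : IsState σ) (hc : c < c') :
    ∀ᶠ n : ℕ in atTop, ∀ A : Matrix (Fin n → ι) (Fin n → ι) ℂ, A.PosSemidef →
      (1 - A).PosSemidef → 1 / 2 * Real.exp (-(n * c')) ≤
        (tensorPower n ρ * (1 - A)).trace.re + (tensorPower n σ * A).trace.re := by
  obtain ⟨U, a, hU, ha, hρU, -, hρp⟩ := hρ.exists_conjDiag
  obtain ⟨V, b, hV, hb, hσV, -, hσp⟩ := hσ.exists_conjDiag
  -- Nussbaum-Szkoła weights: since `w ^ s * w ^ (1 - s) = w`, the classical Chernoff sum of `p` and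
  -- `q` is exactly the quantum trace.
  let w : ι → ι → ℝ := fun x y => ‖(Uᴴ * V) x y‖ ^ 2
  have hw : ∀ x y, 0 ≤ w x y := fun x y => sq_nonneg _
  let p : ι × ι → ℝ := fun z => w z.1 z.2 * a z.1
  let q : ι × ι → ℝ := fun z => w z.1 z.2 * b z.2
  have hsum : ∀ s ∈ Set.Ioo (0 : ℝ) 1, Real.exp (-c) ≤ chernoffSum p q s := by
    intro s hs
    refine (h s hs).trans_eq ?_
    rw [hρp, hσp, re_trace_conjDiag_mul, chernoffSum, Fintype.sum_prod_type]
    refine Finset.sum_congr rfl fun x _ => Finset.sum_congr rfl fun y _ => ?_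
    simp only [p, q]
    rw [Real.mul_rpow (hw x y) (ha x).1, Real.mul_rpow (hw x y) (hb y).1]
    have : w x y = w x y ^ s * w x y ^ (1 - s) := by
      rw [← Real.rpow_add_of_nonneg (hw x y) hs.1.le (sub_nonneg.2 hs.2.le), add_sub_cancel,
        Real.rpow_one]
    change _ * w x y = _
    conv_lhs => rw [this]
    ring
  filter_upwards [eventually_exp_le_overlap (fun z => mul_nonneg (hw _ _) (ha _).1)
    (fun z => mul_nonneg (hw _ _) (hb _).1) hc hsum] with n hn A hA hA1
  have hT : ∀ W : Matrix ι ι ℂ, W * Wᴴ = 1 → tensorPower n W * (tensorPower n W)ᴴ = 1 := by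
    intro W hW
    rw [← tensorPower_conjTranspose, ← tensorPower_mul, hW, tensorPower_one]
  rw [hρU, hσV, tensorPower_conjDiag, tensorPower_conjDiag]
  refine le_trans ?_ (half_overlap_le_test_error (hT U hU) (hT V hV)
    (fun x => Finset.prod_nonneg fun k _ => (ha _).1)
    (fun x => Finset.prod_nonneg fun k _ => (hb _).1) hA hA1)
  refine mul_le_mul_of_nonneg_left (hn.trans_eq ?_) (by norm_num)
  -- The weights of the tensor powers are products of the one-copy weights, so the quantum overlap
  -- is the classical `overlap p q n`.
  rw [overlap, ← Fintype.sum_prod_type',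
    ← (Equiv.arrowProdEquivProdArrow (Fin n) (fun _ => ι) (fun _ => ι)).sum_comp]
  refine Finset.sum_congr rfl fun z _ => ?_
  rw [← tensorPower_conjTranspose, ← tensorPower_mul]
  simp only [tensorPower, Matrix.of_apply, Equiv.arrowProdEquivProdArrow, Equiv.coe_fn_mk,
    Finset.prod_mul_distrib, norm_prod, ← Finset.prod_pow, w]
  rw [mul_min_of_nonneg _ _ (Finset.prod_nonneg fun i _ => sq_nonneg _)]

/-! ### Upper semicontinuity of the Chernoff divergence -/

section Semicontinuity

open scoped Matrix.Norms.L2Operator in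
theorem continuousWithinAt_matPow {ρ : Matrix ι ι ℂ} {s : ℝ} (hs : 0 ≤ s) (hρ : IsState ρ) :
    ContinuousWithinAt (fun τ => matPow τ s) {τ | IsState τ} ρ := by
  refine (ContinuousOn.cfc' (A := Matrix ι ι ℂ) (s := Set.Icc (0 : ℝ) 1) isCompact_Icc
    (fun x : ℝ => x ^ s) continuousOn_id ?_ ?_ ?_) ρ hρ
  · intro τ hτ
    obtain ⟨U, a, -, ha, -, hsp, -⟩ := IsState.exists_conjDiag hτ
    rw [id, hsp]
    rintro _ ⟨x, rfl⟩
    exact ha x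
  · exact fun τ hτ => hτ.1.1
  · exact (Real.continuous_rpow_const hs).continuousOn

/-- Eigenvalues of states lie in `[0, 1]`, so their powers decrease in the exponent. One mesh
inequality thus controls all `s` in its cell. -/
theorem re_trace_matPow_anti {ρ σ : Matrix ι ι ℂ} (hρ : IsState ρ) (hσ : IsState σ)
    {a s b : ℝ} (has : a ≤ s) (hsb : s ≤ b) (hs : s ∈ Set.Ioo (0 : ℝ) 1) :
    (matPow ρ b * matPow σ (1 - a)).trace.re ≤ (matPow ρ s * matPow σ (1 - s)).trace.re := by
  obtain ⟨U, d, -, hd, -, -, hρp⟩ := hρ.exists_conjDiag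
  obtain ⟨V, e, -, he, -, -, hσp⟩ := hσ.exists_conjDiag
  simp only [hρp, hσp, re_trace_conjDiag_mul]
  have mono : ∀ {x u v : ℝ}, 0 ≤ x → x ≤ 1 → 0 < u → u ≤ v → x ^ v ≤ x ^ u := by
    intro x u v hx hx1 hu huv
    exact Real.rpow_le_rpow_of_exponent_ge_of_imp hx hx1 huv fun _ h =>
      absurd h (hu.trans_le huv).ne'
  refine Finset.sum_le_sum fun x _ => Finset.sum_le_sum fun y _ =>
    mul_le_mul_of_nonneg_right (mul_le_mul (mono (hd x).1 (hd x).2 hs.1 hsb)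
      (mono (he y).1 (he y).2 (sub_pos.2 hs.2) (by linarith)) (Real.rpow_nonneg (he y).1 _)
      (Real.rpow_nonneg (hd x).1 _)) (sq_nonneg _)

/-- Upper semicontinuity of the quantum Chernoff divergence. -/
theorem ChernoffLE.eventually_nhdsWithin {c c' : ℝ} {ρ σ : Matrix ι ι ℂ} (h : ChernoffLE c ρ σ)
    (hρ : IsState ρ) (hσ : IsState σ) (hc : c < c') :
    ∀ᶠ τ : Matrix ι ι ℂ × Matrix ι ι ℂ in 𝓝[{τ | IsState τ}] ρ ×ˢ 𝓝[{τ | IsState τ}] σ,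
      ChernoffLE c' τ.1 τ.2 := by
  obtain ⟨U, d, -, hd, -, -, hρp⟩ := hρ.exists_conjDiag
  obtain ⟨V, e, -, he, -, -, hσp⟩ := hσ.exists_conjDiag
  -- A bound for all `s` is reduced to `K` strict inequalities, each stable under perturbation of
  -- the states by continuity of `matPow` at a fixed exponent.
  obtain ⟨K, hK, hmesh⟩ := exists_mesh_exp_lt (X := ι × ι) (p := fun z => d z.1)
    (q := fun z => e z.2) (w := fun z => ‖(Uᴴ * V) z.1 z.2‖ ^ 2) (fun z => (hd _).1)
    (fun z => (he _).1) hc (by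
      intro s hs
      refine (h s hs).trans_eq ?_
      rw [hρp, hσp, re_trace_conjDiag_mul, Fintype.sum_prod_type])
  have hK0 : (0 : ℝ) < K := by exact_mod_cast hK
  have hall : ∀ᶠ τ : Matrix ι ι ℂ × Matrix ι ι ℂ in 𝓝[{τ | IsState τ}] ρ ×ˢ 𝓝[{τ | IsState τ}] σ,
      ∀ k ∈ Finset.range K, Real.exp (-c') <
        (matPow τ.1 ((k + 1 : ℝ) / K) * matPow τ.2 (1 - (k : ℝ) / K)).trace.re := by
    rw [Finset.eventually_all]
    intro k hk
    have hk1 : (k : ℝ) + 1 ≤ K := by exact_mod_cast Finset.mem_range.1 hk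
    have h1 : Tendsto (fun τ => matPow τ ((k + 1 : ℝ) / K)) (𝓝[{τ | IsState τ}] ρ)
      (𝓝 (matPow ρ ((k + 1 : ℝ) / K))) := continuousWithinAt_matPow (by positivity) hρ
    have h2 : Tendsto (fun τ => matPow τ (1 - (k : ℝ) / K)) (𝓝[{τ | IsState τ}] σ)
      (𝓝 (matPow σ (1 - (k : ℝ) / K))) :=
      continuousWithinAt_matPow (sub_nonneg.2 ((div_le_one hK0).2 (by linarith))) hσ
    have hcont : Continuous fun P : Matrix ι ι ℂ × Matrix ι ι ℂ => (P.1 * P.2).trace.re :=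
      Complex.continuous_re.comp (continuous_fst.matrix_mul continuous_snd).matrix_trace
    have h3 := (hcont.tendsto (matPow ρ ((k + 1 : ℝ) / K), matPow σ (1 - (k : ℝ) / K))).comp
      ((h1.comp tendsto_fst).prodMk_nhds (h2.comp tendsto_snd))
    refine h3.eventually (lt_mem_nhds ?_)
    have := hmesh k (Finset.mem_range.1 hk)
    rwa [hρp, hσp, re_trace_conjDiag_mul, ← Fintype.sum_prod_type']
  have hst : ∀ᶠ τ : Matrix ι ι ℂ × Matrix ι ι ℂ in 𝓝[{τ | IsState τ}] ρ ×ˢ 𝓝[{τ | IsState τ}] σ,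
      IsState τ.1 ∧ IsState τ.2 :=
    (tendsto_fst.eventually self_mem_nhdsWithin).and (tendsto_snd.eventually self_mem_nhdsWithin)
  filter_upwards [hall, hst] with τ hτ hτs s hs
  have hfl : (⌊s * K⌋₊ : ℝ) ≤ s * K := Nat.floor_le (mul_nonneg hs.1.le hK0.le)
  have hfl' : s * K < ⌊s * K⌋₊ + 1 := Nat.lt_floor_add_one _
  have hlt : ⌊s * K⌋₊ < K := by
    have : s * K < K := by nlinarith [hs.2]
    exact_mod_cast hfl.trans_lt this
  exact (hτ _ (Finset.mem_range.2 hlt)).le.trans (re_trace_matPow_anti hτs.1 hτs.2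
    ((div_le_iff₀ hK0).2 hfl) ((le_div_iff₀ hK0).2 hfl'.le) hs)

end Semicontinuity

end States

end PACMetrology

end

noncomputable section

namespace PACMetrology

open scoped ComplexOrder

open Matrix

/-! ### From estimators to binary tests -/

section HitProb

variable {κ : Type*} [Fintype κ] [DecidableEq κ]

theorem measurableSet_hit (δ t : ℝ) : MeasurableSet {τ : ℝ | |t - τ| ≤ δ} :=
  (isClosed_le (continuous_const.sub continuous_id).abs continuous_const).measurableSet

theorem POVM.one_sub_effect (Q : POVM κ) {s : Set ℝ} (hs : MeasurableSet s) :
    1 - Q.effect s = Q.effect sᶜ := by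
  rw [← Q.effect_univ, ← Set.union_compl_self s,
    Q.effect.of_union disjoint_compl_right hs hs.compl, add_sub_cancel_left]

theorem POVM.posSemidef_one_sub_effect (Q : POVM κ) {s : Set ℝ} (hs : MeasurableSet s) :
    (1 - Q.effect s).PosSemidef := by
  rw [Q.one_sub_effect hs]
  exact Q.posSemidef _ hs.compl

theorem re_trace_mul_one_sub {ρ A : Matrix κ κ ℂ} (hρ : IsState ρ) :
    (ρ * (1 - A)).trace.re = 1 - (ρ * A).trace.re := by
  rw [Matrix.mul_sub, mul_one, Matrix.trace_sub, hρ.2, Complex.sub_re, Complex.one_re]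

theorem hitProb_le_one {δ : ℝ} {ρ : ℝ → Matrix κ κ ℂ} {Q : POVM κ} {t : ℝ} (hρ : IsState (ρ t)) :
    hitProb δ ρ Q t ≤ 1 := by
  rw [hitProb, ENNReal.ofReal_le_one]
  have := re_trace_mul_nonneg hρ.1 (Q.posSemidef_one_sub_effect (measurableSet_hit δ t))
  rw [re_trace_mul_one_sub hρ] at this
  linarith

/-- Estimating two values whose tolerance intervals are disjoint discriminates the two states. -/
theorem hitProb_add_hitProb_add_le {δ e : ℝ} {ρ : ℝ → Matrix κ κ ℂ} {t t' : ℝ}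
    (hρ : IsState (ρ t)) (hρ' : IsState (ρ t')) (htt : 2 * δ < |t - t'|) (he : 0 ≤ e)
    (h : ∀ A : Matrix κ κ ℂ, A.PosSemidef → (1 - A).PosSemidef →
      e ≤ (ρ t * (1 - A)).trace.re + (ρ t' * A).trace.re) (Q : POVM κ) :
    hitProb δ ρ Q t + hitProb δ ρ Q t' + ENNReal.ofReal e ≤ 2 := by
  have hs := measurableSet_hit δ t
  have hs' := measurableSet_hit δ t'
  have hdisj : Disjoint {τ : ℝ | |t - τ| ≤ δ} {τ : ℝ | |t' - τ| ≤ δ} := by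
    rw [Set.disjoint_left]
    intro τ h1 h2
    have h1 : |t - τ| ≤ δ := h1
    have h2 : |t' - τ| ≤ δ := h2
    have := abs_sub_le t τ t'
    rw [abs_sub_comm τ t'] at this
    linarith
  have h1 := h _ (Q.posSemidef _ hs) (Q.posSemidef_one_sub_effect hs)
  -- A hit for `t'` excludes a hit for `t`, so `hitProb` at `t'` is at most one minus the second
  -- error of the test in `h1`.
  have h2 : 0 ≤ (ρ t' * (1 - (Q.effect {τ : ℝ | |t - τ| ≤ δ} +
      Q.effect {τ : ℝ | |t' - τ| ≤ δ}))).trace.re := by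
    rw [← Q.effect.of_union hdisj hs hs']
    exact re_trace_mul_nonneg hρ'.1 (Q.posSemidef_one_sub_effect (hs.union hs'))
  rw [re_trace_mul_one_sub hρ] at h1
  rw [re_trace_mul_one_sub hρ', Matrix.mul_add, Matrix.trace_add, Complex.add_re] at h2
  have p1 := re_trace_mul_nonneg hρ.1 (Q.posSemidef _ hs)
  have p2 := re_trace_mul_nonneg hρ'.1 (Q.posSemidef _ hs')
  rw [hitProb, hitProb, ← ENNReal.ofReal_add p1 p2, ← ENNReal.ofReal_add (add_nonneg p1 p2) he,
    ← ENNReal.ofReal_ofNat 2]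
  exact ENNReal.ofReal_le_ofReal (by linarith)

theorem optMinimaxSuccess_le_optBayesSuccess {δ : ℝ} {Θ : Set ℝ} {ρ : ℝ → Matrix κ κ ℂ}
    {μ : Measure ℝ} [IsProbabilityMeasure μ] (hμΘ : μ Θᶜ = 0) :
    optMinimaxSuccess δ Θ ρ ≤ optBayesSuccess δ μ ρ := by
  refine iSup_mono fun Q => ?_
  calc minimaxSuccess δ Θ ρ Q = ∫⁻ _, minimaxSuccess δ Θ ρ Q ∂μ := by simp
    _ ≤ _ := lintegral_mono_ae (by
      filter_upwards [measure_eq_zero_iff_ae_notMem.1 hμΘ] with t ht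
      exact iInf₂_le t (not_not.1 ht))

end HitProb

theorem le_one_sub_of_two_mul_add_le {x d : ℝ≥0∞} (h : 2 * x + 2 * d ≤ 2) : x ≤ 1 - d := by
  rw [← mul_add] at h
  have h' : x + d ≤ 1 := by
    rw [← ENNReal.mul_le_mul_iff_right two_ne_zero ENNReal.ofNat_ne_top, mul_one]
    exact h
  exact ENNReal.le_sub_of_add_le_right (ne_top_of_le_ne_top ENNReal.one_ne_top
    (le_add_self.trans h')) h'

theorem le_one_sub_iSup {α : Type*} [Nonempty α] {f : α → ℝ≥0∞} {d : ℝ≥0∞}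
    (h : ∀ a, 2 * f a + 2 * d ≤ 2) : d ≤ 1 - ⨆ a, f a := by
  have hd : d ≤ 1 := by
    obtain ⟨a⟩ := ‹Nonempty α›
    rw [← ENNReal.mul_le_mul_iff_right two_ne_zero ENNReal.ofNat_ne_top, mul_one]
    exact le_add_self.trans (h a)
  have h1 : ⨆ a, f a ≤ 1 - d := iSup_le fun a => le_one_sub_of_two_mul_add_le (h a)
  calc d = 1 - (1 - d) := (ENNReal.sub_sub_cancel ENNReal.one_ne_top hd).symm
    _ ≤ _ := tsub_le_tsub_left h1 1

/-! ### Asymptotic rates -/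

section Rate

theorem asymptoticRate_mono {η η' : ℕ → ℝ≥0∞} (h : ∀ n, η n ≤ η' n) :
    asymptoticRate η ≤ asymptoticRate η' := by
  refine limsup_le_limsup (Eventually.of_forall fun n => ?_)
  refine EReal.div_le_div_right_of_nonneg (by exact_mod_cast n.cast_nonneg) ?_
  exact EReal.neg_le_neg_iff.2 (ENNReal.log_le_log (tsub_le_tsub_left (h n) 1))

/-- For any `c' > c`, the constant `C` eventually exceeds `exp (-(n (c' - c)))`, so it costs nothing
in the rate. -/
theorem asymptoticRate_le {η : ℕ → ℝ≥0∞} {c C : ℝ} (hC : 0 < C)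
    (h : ∀ᶠ n : ℕ in atTop, ENNReal.ofReal (C * Real.exp (-(n * c))) ≤ 1 - η n) :
    asymptoticRate η ≤ c := by
  refine EReal.le_of_forall_lt_iff_le.1 fun c' hc => ?_
  have hc' : 0 < c' - c := sub_pos.2 (EReal.coe_lt_coe_iff.1 hc)
  have hsmall : ∀ᶠ n : ℕ in atTop, Real.exp (-(c' - c)) ^ n < C :=
    (tendsto_pow_atTop_nhds_zero_of_lt_one (Real.exp_pos _).le
      (Real.exp_lt_one_iff.2 (by linarith))).eventually (gt_mem_nhds hC)
  refine limsup_le_of_le (by isBoundedDefault) ?_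
  filter_upwards [h, hsmall, eventually_gt_atTop 0] with n hn hs hpos
  refine (EReal.div_le_iff_le_mul (by exact_mod_cast hpos) (EReal.natCast_ne_top n)).2 ?_
  rw [EReal.neg_le]
  have h1 : Real.exp (-(n * c')) ≤ C * Real.exp (-(n * c)) := by
    rw [← Real.exp_nat_mul] at hs
    calc Real.exp (-(n * c')) = Real.exp (n * -(c' - c)) * Real.exp (-(n * c)) := by
          rw [← Real.exp_add]; ring_nf
      _ ≤ _ := mul_le_mul_of_nonneg_right hs.le (Real.exp_pos _).le
  have h2 := ENNReal.log_le_log ((ENNReal.ofReal_le_ofReal h1).trans hn)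
  rw [ENNReal.log_ofReal_of_pos (Real.exp_pos _), Real.log_exp] at h2
  exact_mod_cast h2

end Rate

/-! ### Bounds on the minimax and Bayesian rates -/

section Bounds

variable {ι : Type*}

instance {κ : Type*} [Fintype κ] [DecidableEq κ] : Nonempty (POVM κ) := by
  refine ⟨⟨VectorMeasure.dirac (0 : ℝ) (1 : Matrix κ κ ℂ), fun s hs => ?_, ?_⟩⟩
  · by_cases h : (0 : ℝ) ∈ s
    · rw [VectorMeasure.dirac_apply_of_mem hs h]
      exact Matrix.PosSemidef.one
    · rw [VectorMeasure.dirac_apply_of_notMem h]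
      exact Matrix.PosSemidef.zero
  · simp

theorem minimaxRate_le_chernoff [Fintype ι] [DecidableEq ι] {δ : ℝ} {Θ : Set ℝ} {ρ : ℝ → Matrix ι ι ℂ}
    (hρ : ∀ t ∈ Θ, IsState (ρ t)) {t t' : ℝ} (ht : t ∈ Θ) (ht' : t' ∈ Θ)
    (htt : 2 * δ < |t - t'|) : minimaxRate δ Θ ρ ≤ chernoff (ρ t) (ρ t') := by
  refine EReal.le_of_forall_lt_iff_le.1 fun c' hc' => ?_
  obtain ⟨c, hc, hcc⟩ := EReal.lt_iff_exists_real_btwn.1 hc'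
  refine asymptoticRate_le (C := 1 / 4) (by norm_num) ?_
  filter_upwards [(chernoffLE_of_chernoff_lt hc).eventually_test_error (hρ t ht) (hρ t' ht')
    (EReal.coe_lt_coe_iff.1 hcc)] with n hn
  refine le_one_sub_iSup fun Q => ?_
  refine le_trans ?_ (hitProb_add_hitProb_add_le (ρ := fun t => tensorPower n (ρ t))
    (isState_tensorPower (hρ t ht) n) (isState_tensorPower (hρ t' ht') n) htt (by positivity) hn Q)
  refine add_le_add ?_ (le_of_eq ?_)
  · rw [two_mul]
    exact add_le_add (iInf₂_le t ht) (iInf₂_le t' ht')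
  · rw [← ENNReal.ofReal_ofNat 2, ← ENNReal.ofReal_mul (by norm_num)]
    ring_nf

/-- `t` is an essential value of `ρ` if the prior charges every neighbourhood of `(t, ρ t)`
in the graph of `ρ`. -/
def IsEssential (μ : Measure ℝ) (ρ : ℝ → Matrix ι ι ℂ) (t : ℝ) : Prop :=
  ∀ V ∈ 𝓝 t, ∀ W ∈ 𝓝 (ρ t), μ {s | s ∈ V ∧ ρ s ∈ W} ≠ 0

/-- The graph lies in a second countable space, so countably many null boxes cover its inessential
points. Pushing forward the outer measure gives every subset of that space a value, and local
nullity becomes nullity. -/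
theorem measure_not_isEssential [Fintype ι] (μ : Measure ℝ) (ρ : ℝ → Matrix ι ι ℂ) :
    μ {t | ¬ IsEssential μ ρ t} = 0 := by
  have : SecondCountableTopology (Matrix ι ι ℂ) :=
    inferInstanceAs (SecondCountableTopology (ι → ι → ℂ))
  let g : ℝ → ℝ × Matrix ι ι ℂ := fun t => (t, ρ t)
  have h := measure_null_of_locally_null (μ := OuterMeasure.map g μ.toOuterMeasure)
    (g '' {t | ¬ IsEssential μ ρ t}) (by
      rintro _ ⟨t, ht, rfl⟩
      simp only [IsEssential, Set.mem_ofPred_eq, not_forall, not_not] at ht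
      obtain ⟨V, hV, W, hW, h0⟩ := ht
      exact ⟨V ×ˢ W, mem_nhdsWithin_of_mem_nhds (prod_mem_nhds hV hW), h0⟩)
  rw [OuterMeasure.map_apply] at h
  exact measure_mono_null (Set.subset_preimage_image g _) h

/-- If a set of pairs of parameter values of positive prior weight is hard to discriminate, the
Bayesian error cannot be smaller. -/
theorem two_mul_bayesSuccess_add_le {κ : Type*} [Fintype κ] [DecidableEq κ] {δ : ℝ}
    {μ : Measure ℝ} [IsProbabilityMeasure μ] {ρ : ℝ → Matrix κ κ ℂ} {Q : POVM κ}
    (hρ : ∀ᵐ t ∂μ, IsState (ρ t)) {e : ℝ≥0∞} {E : Set (ℝ × ℝ)}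
    (hE : ∀ r ∈ E, hitProb δ ρ Q r.1 + hitProb δ ρ Q r.2 + e ≤ 2) :
    2 * bayesSuccess δ μ ρ Q + e * (μ.prod μ) E ≤ 2 := by
  -- A measurable minorant with the same lower integral; as `p` lies below `hitProb`, the measurable
  -- set `F` contains `E`.
  obtain ⟨p, hpm, hple, hpint⟩ := exists_measurable_le_lintegral_eq (μ := μ) (hitProb δ ρ Q)
  let F : Set (ℝ × ℝ) := {r | p r.1 + p r.2 + e ≤ 2}
  have hpm1 : Measurable fun r : ℝ × ℝ => p r.1 := hpm.comp measurable_fst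
  have hpm2 : Measurable fun r : ℝ × ℝ => p r.2 := hpm.comp measurable_snd
  have hF : MeasurableSet F :=
    measurableSet_le ((hpm1.add hpm2).add measurable_const) measurable_const
  have hEF : E ⊆ F := fun r hr => le_trans (by gcongr <;> exact hple _) (hE r hr)
  have hp1 : ∀ᵐ t ∂μ, p t ≤ 1 := hρ.mono fun t ht => (hple t).trans (hitProb_le_one ht)
  have hae : ∀ᵐ r ∂μ.prod μ, p r.1 + p r.2 + F.indicator (fun _ => e) r ≤ 2 := by
    filter_upwards [measurePreserving_fst.quasiMeasurePreserving.ae hp1,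
      measurePreserving_snd.quasiMeasurePreserving.ae hp1] with r h1 h2
    by_cases hr : r ∈ F
    · rw [Set.indicator_of_mem hr]; exact hr
    · rw [Set.indicator_of_notMem hr, add_zero, ← one_add_one_eq_two]
      exact add_le_add h1 h2
  have hint := lintegral_mono_ae hae
  rw [lintegral_add_left (f := fun r : ℝ × ℝ => p r.1 + p r.2) (hpm1.add hpm2), lintegral_add_left hpm1,
    measurePreserving_fst.lintegral_comp hpm, measurePreserving_snd.lintegral_comp hpm,
    lintegral_indicator_const hF, lintegral_const, measure_univ, mul_one, ← two_mul, ← hpint]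
    at hint
  refine le_trans ?_ hint
  gcongr
  exact le_rfl

theorem bayesRate_le_chernoff [Fintype ι] [DecidableEq ι] {δ : ℝ} {Θ : Set ℝ} {ρ : ℝ → Matrix ι ι ℂ}
    (hρ : ∀ t ∈ Θ, IsState (ρ t)) {μ : Measure ℝ} [IsProbabilityMeasure μ] (hμΘ : μ Θᶜ = 0)
    {t t' : ℝ} (ht : t ∈ Θ) (ht' : t' ∈ Θ) (hess : IsEssential μ ρ t) (hess' : IsEssential μ ρ t')
    (htt : 2 * δ < |t - t'|) : bayesRate δ μ ρ ≤ chernoff (ρ t) (ρ t') := by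
  refine EReal.le_of_forall_lt_iff_le.1 fun c₂ hc₂ => ?_
  obtain ⟨c, hc, hcc⟩ := EReal.lt_iff_exists_real_btwn.1 hc₂
  -- The gap from `c` to `c₁` is spent on semicontinuity, the one from `c₁` to `c₂` on the test
  -- error.
  obtain ⟨c₁, hc1, hc2⟩ := exists_between (EReal.coe_lt_coe_iff.1 hcc)
  have husc := (chernoffLE_of_chernoff_lt hc).eventually_nhdsWithin (hρ t ht) (hρ t' ht') hc1
  obtain ⟨W₀, hW₀, W₀', hW₀', hWW⟩ := Filter.mem_prod_iff.1 husc
  obtain ⟨W, hW, hWs⟩ := mem_nhdsWithin_iff_exists_mem_nhds_inter.1 hW₀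
  obtain ⟨W', hW', hWs'⟩ := mem_nhdsWithin_iff_exists_mem_nhds_inter.1 hW₀'
  have hdist : ∀ᶠ r : ℝ × ℝ in 𝓝 t ×ˢ 𝓝 t', 2 * δ < |r.1 - r.2| := by
    rw [← nhds_prod_eq]
    exact ((continuous_fst.sub continuous_snd).abs.tendsto (t, t')).eventually (lt_mem_nhds htt)
  obtain ⟨V, hV, V', hV', hVV⟩ := Filter.mem_prod_iff.1 hdist
  let A : Set ℝ := {s | s ∈ V ∧ ρ s ∈ W} ∩ Θ
  let A' : Set ℝ := {s | s ∈ V' ∧ ρ s ∈ W'} ∩ Θ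
  have hA : μ A ≠ 0 := by
    rw [measure_inter_conull hμΘ]
    exact hess V hV W hW
  have hA' : μ A' ≠ 0 := by
    rw [measure_inter_conull hμΘ]
    exact hess' V' hV' W' hW'
  -- The number of copies from which the error bound holds depends on the pair. The sets `E N` cover
  -- `A ×ˢ A'`, which has positive mass, so one `N` serves a set of pairs of positive mass.
  let E : ℕ → Set (ℝ × ℝ) := fun N => {r | r ∈ A ×ˢ A' ∧ ∀ n ≥ N,
    ∀ B : Matrix (Fin n → ι) (Fin n → ι) ℂ, B.PosSemidef →
      (1 - B).PosSemidef → 1 / 2 * Real.exp (-(n * c₂)) ≤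
        (tensorPower n (ρ r.1) * (1 - B)).trace.re + (tensorPower n (ρ r.2) * B).trace.re}
  have hE : A ×ˢ A' ⊆ ⋃ N, E N := by
    rintro ⟨s, s'⟩ ⟨hs, hs'⟩
    have hle : ChernoffLE c₁ (ρ s) (ρ s') :=
      @hWW (ρ s, ρ s') ⟨hWs ⟨hs.1.2, hρ s hs.2⟩, hWs' ⟨hs'.1.2, hρ s' hs'.2⟩⟩
    obtain ⟨N, hN⟩ := eventually_atTop.1
      (hle.eventually_test_error (hρ s hs.2) (hρ s' hs'.2) hc2)
    exact Set.mem_iUnion.2 ⟨N, ⟨hs, hs'⟩, hN⟩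
  obtain ⟨N, hN⟩ : ∃ N, (μ.prod μ) (E N) ≠ 0 := by
    by_contra hcon
    push Not at hcon
    have := measure_mono_null hE (measure_iUnion_null hcon)
    rw [Measure.prod_prod] at this
    exact (mul_ne_zero hA hA') this
  set m := (μ.prod μ) (E N) with hm
  have hmtop : m ≠ ⊤ := measure_ne_top _ _
  have hm0 : 0 < m.toReal := ENNReal.toReal_pos hN hmtop
  -- One factor `1 / 2` is that of the test error; the other comes from dividing by the 2 in front
  -- of `bayesSuccess`.
  refine asymptoticRate_le (C := 1 / 4 * m.toReal) (by positivity) ?_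
  filter_upwards [eventually_ge_atTop N] with n hn
  refine le_one_sub_iSup fun Q => ?_
  have hst : ∀ᵐ s ∂μ, IsState (tensorPower n (ρ s)) := by
    filter_upwards [measure_eq_zero_iff_ae_notMem.1 hμΘ] with s hs
    exact isState_tensorPower (hρ s (not_not.1 hs)) n
  refine le_trans (le_of_eq ?_) (two_mul_bayesSuccess_add_le (δ := δ) (μ := μ) (Q := Q) hst
    (e := ENNReal.ofReal (1 / 2 * Real.exp (-(n * c₂)))) (E := E N) fun r hr =>
      hitProb_add_hitProb_add_le (ρ := fun t => tensorPower n (ρ t))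
        (isState_tensorPower (hρ _ hr.1.1.2) n) (isState_tensorPower (hρ _ hr.1.2.2) n)
        (@hVV r ⟨hr.1.1.1.1, hr.1.2.1.1⟩) (by positivity) (hr.2 n hn) Q)
  rw [← hm, ← ENNReal.ofReal_toReal hmtop, ← ENNReal.ofReal_mul (by positivity),
    ← ENNReal.ofReal_ofNat 2, ← ENNReal.ofReal_mul (by norm_num),
    ENNReal.toReal_ofReal hm0.le]
  ring_nf

/-- Inside the conull set `Θ`, parameters close to `t` have states close to `ρ t`, so charging
neighbourhoods of `t` is enough. -/
theorem IsEssential.of_continuousOn {Θ : Set ℝ} {ρ : ℝ → Matrix ι ι ℂ} {μ : Measure ℝ}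
    (hμΘ : μ Θᶜ = 0) (hcont : ContinuousOn ρ Θ) {t : ℝ} (ht : t ∈ Θ) (hsupp : t ∈ μ.support) :
    IsEssential μ ρ t := by
  intro V hV W hW
  obtain ⟨U, hU, hUs⟩ := mem_nhdsWithin_iff_exists_mem_nhds_inter.1 (hcont t ht hW)
  have hpos := (Measure.mem_support_iff_forall t).1 hsupp _ (inter_mem hV hU)
  rw [← measure_inter_conull hμΘ] at hpos
  exact (hpos.trans_le (measure_mono fun s hs =>
    show s ∈ V ∧ ρ s ∈ W from ⟨hs.1.1, hUs ⟨hs.1.2, hs.2⟩⟩)).ne'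

theorem IsEssential.mem_support {ρ : ℝ → Matrix ι ι ℂ} {μ : Measure ℝ} {t : ℝ}
    (h : IsEssential μ ρ t) : t ∈ μ.support := by
  rw [Measure.mem_support_iff_forall]
  intro V hV
  have := h V hV Set.univ univ_mem
  simpa [pos_iff_ne_zero] using this

end Bounds

end PACMetrology

end

theorem theorem3 {ι : Type*} [Fintype ι] [DecidableEq ι]
    (δ : ℝ) (hδ : 0 ≤ δ)
    (Θ : Set ℝ) (ρ : ℝ → Matrix ι ι ℂ) (hρ : ∀ t ∈ Θ, PACMetrology.IsState (ρ t))
    (μ : Measure ℝ) [IsProbabilityMeasure μ] (hμΘ : μ Θᶜ = 0)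
    (hmeas : ∀ i j, AEMeasurable (fun t => ρ t i j) μ) :
    -- the minimax rate is at most the Bayesian rate
    PACMetrology.minimaxRate δ Θ ρ ≤ PACMetrology.bayesRate δ μ ρ ∧
    -- Chernoff bound for the Bayesian rate, up to a null set of parameter values
    (∃ S : Set ℝ, S ⊆ Θ ∩ μ.support ∧ μ Sᶜ = 0 ∧
      PACMetrology.bayesRate δ μ ρ ≤ PACMetrology.infChernoff δ S ρ) ∧
    -- if `ρ` is continuous there are no exceptional values in the support of the prior
    (ContinuousOn ρ Θ →
      PACMetrology.bayesRate δ μ ρ ≤ PACMetrology.infChernoff δ (Θ ∩ μ.support) ρ) ∧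
    -- Chernoff bound for the minimax rate, with every admissible parameter value
    PACMetrology.minimaxRate δ Θ ρ ≤ PACMetrology.infChernoff δ Θ ρ := by
  open PACMetrology in
  refine ⟨asymptoticRate_mono fun n => optMinimaxSuccess_le_optBayesSuccess hμΘ,
    -- The exceptional null set consists of the inessential values and the complement of `Θ`.
    ⟨Θ ∩ {t | IsEssential μ ρ t}, fun t ht => ⟨ht.1, IsEssential.mem_support ht.2⟩, ?_, ?_⟩,
    fun hcont => ?_, ?_⟩
  · rw [Set.compl_inter]
    exact measure_union_null hμΘ (measure_not_isEssential μ ρ)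
  · exact le_iInf₂ fun t ht => le_iInf₂ fun t' ht' => le_iInf fun htt =>
      bayesRate_le_chernoff hρ hμΘ ht.1 ht'.1 ht.2 ht'.2 htt
  · exact le_iInf₂ fun t ht => le_iInf₂ fun t' ht' => le_iInf fun htt =>
      bayesRate_le_chernoff hρ hμΘ ht.1 ht'.1 (.of_continuousOn hμΘ hcont ht.1 ht.2)
        (.of_continuousOn hμΘ hcont ht'.1 ht'.2) htt
  · exact le_iInf₂ fun t ht => le_iInf₂ fun t' ht' => le_iInf fun htt =>
      minimaxRate_le_chernoff hρ ht ht' htt
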